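/- **Model.** There are $k$ sites and a coordinator. Time proceeds in synchronous rounds: in each round each site observes at most one element (or none) and may send a message to the coordinator, after which the coordinator may send a message to each site. A site's message depends on its random bits, on its past observations and received messages, and on its present observation; the coordinator's messages and its sample depend on its random bits and on all messages received so far. All nodes may use internal randomness; message length, memory and computation are unrestricted. The elements of the union of the streams are pairwise distinct; their number, order of arrival, and distribution over sites and rounds are arbitrary. A protocol is *correct* for sample size $s$ if, on every input and at the end of every round, the coordinator holds a uniformly random subset, of size $\min\{m,s\}$, of the set of the $m$ elements observed so far (a uniform sample without replacement). The cost is the number of messages transmitted, in both directions. **Theorem.** For every constant $0<q<1$ there is a constant $C=C(q)>0$ such that for all integers $k\ge 1$, $s\ge 1$ and $n\ge k$ (and every universe with at least $n$ elements) there is a probability distribution on inputs with exactly $n$ elements, which depends on $q,k,s,n$ and the universe but not on the protocol, such that every correct protocol for $k$ sites and sample size $s$, run on an input drawn from it, 1. transmits at least $C\,\dfrac{k\log(n/s)}{\log(1+k/s)}$ messages with probability at least $1-q$, over the input and the protocol's internal randomness, and 2. transmits at least $C\,\dfrac{k\log(n/s)}{\log(1+k/s)}$ messages in expectation. Moreover,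 for every correct protocol there is a fixed input in the support of this distribution on which both bounds hold over the protocol's internal randomness alone. -/

import Mathlib

open MeasureTheory
open scoped ENNReal

namespace DistributedSampling

/-- An arrival pattern for `k` sites: `x r j` is the element observed by site `j` in round `r`
(`none` if it observes nothing in that round). Rounds are numbered from `0`. -/
abbrev Input (k : ℕ) (α : Type*) : Type _ := ℕ → Fin k → Option α

/-- The elements of the union of the streams are pairwise distinct. -/
def Input.Distinct {k : ℕ} {α : Type*} (x : Input k α) : Prop :=
  ∀ r j r' j' a, x r j = some a → x r' j' = some a → r = r' ∧ j = j'

open Classical in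
/-- The set of all elements observed by the sites in the first `T` rounds. -/
noncomputable def Input.arrived {k : ℕ} {α : Type*} (x : Input k α) (T : ℕ) : Finset α :=
  (Finset.range T).biUnion fun r => Finset.univ.biUnion fun j => (x r j).toFinset

/-- A randomized protocol between `k` sites and a coordinator in the synchronous round model.
`ω : Ω` is the concatenation of the random strings of all the nodes; `U` and `D` are the types of
messages to and from the coordinator. No bound is put on the size of a message, on memory, or on
local computation.

In each round every site may observe an element and may send a message, which depends on its
random string, on the past rounds as seen by this site (its observation and the message that it
got from the coordinator, for each past round, oldest first) and on its present observation. The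
coordinator, knowing all the messages received so far, those of the present round included
(oldest round first), may then send a message to each of the sites, and outputs its sample.
`none` stands for no message. -/
structure Protocol (k : ℕ) (α Ω U D : Type*) where
  site : Fin k → Ω → List (Option α × Option D) → Option α → Option U
  coord : Ω → List (Fin k → Option U) → Fin k → Option D
  sample : Ω → List (Fin k → Option U) → Finset α

namespace Protocol

variable {k : ℕ} {α Ω U D : Type*}

/-- The local histories of the sites and the history of the coordinator after the first `r`
rounds. -/
def run (P : Protocol k α Ω U D) (ω : Ω) (x : Input k α) :
    ℕ → (Fin k → List (Option α × Option D)) × List (Fin k → Option U)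
  | 0 => (fun _ => [], [])
  | r + 1 =>
    let h := P.run ω x r
    let c := h.2 ++ [fun j => P.site j ω (h.1 j) (x r j)]
    (fun j => h.1 j ++ [(x r j, P.coord ω c j)], c)

/-- The message sent by site `j` to the coordinator in round `r`. -/
def up (P : Protocol k α Ω U D) (ω : Ω) (x : Input k α) (r : ℕ) (j : Fin k) : Option U :=
  P.site j ω ((P.run ω x r).1 j) (x r j)

/-- The message sent by the coordinator to site `j` in round `r`. -/
def down (P : Protocol k α Ω U D) (ω : Ω) (x : Input k α) (r : ℕ) (j : Fin k) : Option D :=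
  P.coord ω (P.run ω x (r + 1)).2 j

/-- The sample held by the coordinator at the end of round `r`. -/
def sampleAt (P : Protocol k α Ω U D) (ω : Ω) (x : Input k α) (r : ℕ) : Finset α :=
  P.sample ω (P.run ω x (r + 1)).2

/-- The number of messages transmitted, in both directions, in the first `T` rounds. -/
def messages (P : Protocol k α Ω U D) (ω : Ω) (x : Input k α) (T : ℕ) : ℕ :=
  ∑ r ∈ Finset.range T, ∑ j : Fin k,
    ((if (P.up ω x r j).isSome then 1 else 0) + (if (P.down ω x r j).isSome then 1 else 0))

/-- On every input, whether a message is sent over a given link in a given round, and which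
sample is held, are random variables. -/
structure IsMeasurable [MeasurableSpace Ω] (P : Protocol k α Ω U D) : Prop where
  up : ∀ x r j, MeasurableSet {ω | (P.up ω x r j).isSome}
  down : ∀ x r j, MeasurableSet {ω | (P.down ω x r j).isSome}
  sample : ∀ x r A, MeasurableSet {ω | P.sampleAt ω x r = A}

end Protocol

/-- The random set `X` is a uniform sample without replacement, of size `min (#S) s`, from `S`:
each subset of `S` of this size is taken with the same probability, and these probabilities sum
to one. -/
def IsUniformSample {α Ω : Type*} [MeasurableSpace Ω] (μ : Measure Ω) (X : Ω → Finset α)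
    (S : Finset α) (s : ℕ) : Prop :=
  ∀ A : Finset α, A ⊆ S → A.card = min S.card s →
    μ {ω | X ω = A} = ((S.card.choose (min S.card s) : ℕ) : ℝ≥0∞)⁻¹

/-- The protocol is correct for sample size `s`: on every input, at the end of every round, the
coordinator holds a uniform sample without replacement of the elements observed so far. -/
def Protocol.Correct {k : ℕ} {α Ω U D : Type*} [MeasurableSpace Ω] (P : Protocol k α Ω U D)
    (μ : Measure Ω) (s : ℕ) : Prop :=
  ∀ x : Input k α, x.Distinct → ∀ r : ℕ,
    IsUniformSample μ (fun ω => P.sampleAt ω x r) (x.arrived (r + 1)) s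

/-- The quantity `k log (n/s) / log (1 + k/s)`, with logarithms to the base `2`. -/
noncomputable def bound (k s n : ℕ) : ℝ :=
  (k : ℝ) * Real.logb 2 ((n : ℝ) / s) / Real.logb 2 (1 + (k : ℝ) / s)

end DistributedSampling

/-! The hard inputs arrive in stages. With `m` elements already present, each active site of a stage
observes a block of `L` new ones, where `A * m ≤ s * L`; if a single such block were added, a
uniform sample would miss it with probability at most `1 / (A + 1) ≤ δ`. All blocks of a stage fall
into one window, drawn uniformly from many. The windows deal with protocols in which silence carries
information: a protocol that talks while nothing arrives pays for it in too many windows.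

Fix a stage and an active site `j`. Let `z` be the whole input, `x` the input that stops before this
stage, and `y` the input `x` with the block of `j` alone added. On `x`, the message counter moves in
at most `B` windows while it is below `B`, so a random window is most likely silent on `x`. If
moreover the link of `j` is silent on `z`, the coordinator cannot tell `y` from `x`
(`run_snd_eq_of_silent`) and holds the same sample on both, which is rare
(`IsUniformSample.measureReal_eq_le`). With `K` pairs of a stage and an active site, each pair is
silent while fewer than `K` messages are sent with average probability at most `2 * δ`
(`sum_measureReal_linkSilent_le`). Fewer than `K / 2` messages leave at least half of the pairs
silent, so by Markov this has average probability at most `4 * δ` (`sum_measureReal_messages_ge`).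

A stage with all `k` sites multiplies the number of elements by at most `1 + (A + 1) * (k / s)`, so
enough stages fit into `n` elements to make `K` at least a constant times `bound k s n`
(`exists_stages`). -/

namespace DistributedSampling

/-! ### Runs of a protocol and indistinguishability of inputs -/

namespace Protocol

variable {k : ℕ} {α Ω U D : Type*} (P : Protocol k α Ω U D)

theorem run_succ_fst (ω : Ω) (x : Input k α) (r : ℕ) (j : Fin k) :
    (P.run ω x (r + 1)).1 j = (P.run ω x r).1 j ++ [(x r j, P.down ω x r j)] := rfl

theorem run_succ_snd (ω : Ω) (x : Input k α) (r : ℕ) :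
    (P.run ω x (r + 1)).2 = (P.run ω x r).2 ++ [P.up ω x r] := rfl

theorem run_congr (ω : Ω) {x y : Input k α} {R : ℕ} (h : ∀ r < R, x r = y r) :
    P.run ω x R = P.run ω y R := by
  induction R with
  | zero => rfl
  | succ R ih =>
    have ih := ih fun r hr => h r (by omega)
    simp only [run, ih, h R (by omega)]

theorem up_congr (ω : Ω) {x y : Input k α} {R r : ℕ} (h : ∀ r < R, x r = y r) (hr : r < R) :
    P.up ω x r = P.up ω y r := by
  funext j
  simp only [up, P.run_congr ω (fun r' hr' => h r' (by omega) : ∀ r' < r, x r' = y r'), h r hr]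

theorem down_congr (ω : Ω) {x y : Input k α} {R r : ℕ} (h : ∀ r < R, x r = y r) (hr : r < R) :
    P.down ω x r = P.down ω y r := by
  funext j
  simp only [down, P.run_congr ω (fun r' hr' => h r' (by omega) : ∀ r' < r + 1, x r' = y r')]

theorem messages_congr (ω : Ω) {x y : Input k α} {R : ℕ} (h : ∀ r < R, x r = y r) :
    P.messages ω x R = P.messages ω y R := by
  refine Finset.sum_congr rfl fun r hr => ?_
  rw [Finset.mem_range] at hr
  rw [P.up_congr ω h hr, P.down_congr ω h hr]

theorem messages_mono (ω : Ω) (x : Input k α) : Monotone (P.messages ω x) := fun _ _ h =>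
  Finset.sum_le_sum_of_subset (Finset.range_mono h)

/-- If no message is counted between rounds `t` and `R`, then all links are silent there. -/
theorem silent_of_messages_eq {ω : Ω} {x : Input k α} {t R : ℕ}
    (h : P.messages ω x R ≤ P.messages ω x t) {r : ℕ} (htr : t ≤ r) (hrR : r < R) (j : Fin k) :
    P.up ω x r j = none ∧ P.down ω x r j = none := by
  have h1 : P.messages ω x (r + 1) ≤ P.messages ω x r :=
    (P.messages_mono ω x hrR).trans (h.trans (P.messages_mono ω x htr))
  rw [messages, Finset.sum_range_succ, ← messages] at h1
  have h2 : (∑ j : Fin k, ((if (P.up ω x r j).isSome then 1 else 0) +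
      (if (P.down ω x r j).isSome then 1 else 0))) = 0 := by omega
  have h3 := (Finset.sum_eq_zero_iff.1 h2) j (Finset.mem_univ j)
  constructor
  · by_contra hne
    rw [← ne_eq, Option.ne_none_iff_isSome] at hne
    simp [hne] at h3
  · by_contra hne
    rw [← ne_eq, Option.ne_none_iff_isSome] at hne
    simp [hne] at h3

/-- Indistinguishability. The inputs `x`, `y`, `z` agree before round `t`; in the rounds from `t`
to `R`, the input `y` is that of `z` at site `j` and that of `x` at all other sites. If in these
rounds the run on `x` is silent, and the run on `z` is silent on the link of site `j`, then the
coordinator does not distinguish `y` from `x`. -/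
theorem run_snd_eq_of_silent {ω : Ω} {x y z : Input k α} {t R : ℕ} {j : Fin k}
    (hyx : ∀ r < t, y r = x r) (hyz : ∀ r < t, y r = z r)
    (hyx' : ∀ r, t ≤ r → r < R → ∀ i, i ≠ j → y r i = x r i)
    (hyz' : ∀ r, t ≤ r → r < R → y r j = z r j)
    (hx : ∀ r, t ≤ r → r < R → ∀ i, P.up ω x r i = none ∧ P.down ω x r i = none)
    (hz : ∀ r, t ≤ r → r < R → P.up ω z r j = none ∧ P.down ω z r j = none)
    (htR : t ≤ R) : (P.run ω y R).2 = (P.run ω x R).2 := by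
  suffices H : ∀ r, t ≤ r → r ≤ R → (P.run ω y r).2 = (P.run ω x r).2 ∧
      (∀ i, i ≠ j → (P.run ω y r).1 i = (P.run ω x r).1 i) ∧
      (P.run ω y r).1 j = (P.run ω z r).1 j from (H R htR le_rfl).1
  intro r htr
  induction r, htr using Nat.le_induction with
  | base =>
    intro _
    exact ⟨by rw [P.run_congr ω hyx], fun i _ => by rw [P.run_congr ω hyx],
      by rw [P.run_congr ω hyz]⟩
  | succ r htr ih =>
    intro hrR
    obtain ⟨ih1, ih2, ih3⟩ := ih (by omega)
    have hup : P.up ω y r = P.up ω x r := by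
      funext i
      by_cases hi : i = j
      · subst hi
        rw [(hx r htr hrR i).1, ← (hz r htr hrR).1, up, up, ih3, hyz' r htr hrR]
      · rw [up, up, ih2 i hi, hyx' r htr hrR i hi]
    have hc : (P.run ω y (r + 1)).2 = (P.run ω x (r + 1)).2 := by
      rw [run_succ_snd, run_succ_snd, ih1, hup]
    have hdown : P.down ω y r = P.down ω x r := by
      funext i
      rw [down, down, hc]
    refine ⟨hc, fun i hi => ?_, ?_⟩
    · rw [run_succ_fst, run_succ_fst, ih2 i hi, hyx' r htr hrR i hi, hdown]
    · rw [run_succ_fst, run_succ_fst, ih3, hyz' r htr hrR, hdown, (hx r htr hrR j).2,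
        (hz r htr hrR).2]

theorem IsMeasurable.measurable_messages [MeasurableSpace Ω] {P : Protocol k α Ω U D}
    (hP : P.IsMeasurable) (x : Input k α) (T : ℕ) : Measurable fun ω => P.messages ω x T := by
  unfold messages
  refine Finset.measurable_sum _ fun r _ => Finset.measurable_sum _ fun j _ => ?_
  exact (Measurable.ite (hP.up x r j) measurable_const measurable_const).add
    (Measurable.ite (hP.down x r j) measurable_const measurable_const)

end Protocol

/-! ### Uniform samples of nested sets -/

section Sample

variable {α Ω : Type*} [MeasurableSpace Ω] {μ : Measure Ω} [IsProbabilityMeasure μ]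
  {X Y : Ω → Finset α} {S S' : Finset α} {s : ℕ}

/-- A uniform sample from `S` is almost surely one of the subsets of `S` of the right size. -/
theorem IsUniformSample.measure_compl_eq_zero (hX : IsUniformSample μ X S s)
    (hm : ∀ A, MeasurableSet {ω | X ω = A}) :
    μ {ω | X ω ∈ S.powersetCard (min S.card s)}ᶜ = 0 := by
  have hset : {ω | X ω ∈ S.powersetCard (min S.card s)} =
      ⋃ A ∈ S.powersetCard (min S.card s), {ω | X ω = A} := by
    ext ω; simp
  have hms : MeasurableSet {ω | X ω ∈ S.powersetCard (min S.card s)} := by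
    rw [hset]
    exact Finset.measurableSet_biUnion _ fun A _ => hm A
  rw [prob_compl_eq_zero_iff hms, hset, measure_biUnion_finset _ fun A _ => hm A]
  · rw [Finset.sum_congr rfl fun A hA => hX A (Finset.mem_powersetCard.1 hA).1
      (Finset.mem_powersetCard.1 hA).2, Finset.sum_const, Finset.card_powersetCard, nsmul_eq_mul]
    refine ENNReal.mul_inv_cancel ?_ (ENNReal.natCast_ne_top _)
    exact_mod_cast (Nat.choose_pos (min_le_left _ _)).ne'
  · intro A _ B _ hAB
    exact Set.disjoint_left.2 fun ω h1 h2 => hAB (h1.symm.trans h2)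

/-- Uniform samples of a set and of a larger set are rarely the same. -/
theorem IsUniformSample.measureReal_eq_le (hX : IsUniformSample μ X S s)
    (hY : IsUniformSample μ Y S' s) (hSS' : S ⊆ S')
    (hmX : ∀ A, MeasurableSet {ω | X ω = A}) (hmY : ∀ A, MeasurableSet {ω | Y ω = A}) :
    μ.real {ω | Y ω = X ω} ≤
      (S.card.choose (min S'.card s) : ℝ) / (S'.card.choose (min S'.card s) : ℝ) := by
  have hsub : {ω | Y ω = X ω} ⊆ ({ω | X ω ∈ S.powersetCard (min S.card s)}ᶜ ∪
      {ω | Y ω ∈ S'.powersetCard (min S'.card s)}ᶜ) ∪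
      ⋃ A ∈ S.powersetCard (min S'.card s), {ω | Y ω = A} := by
    intro ω hω
    by_cases h1 : X ω ∈ S.powersetCard (min S.card s)
    · by_cases h2 : Y ω ∈ S'.powersetCard (min S'.card s)
      · refine Or.inr ?_
        simp only [Set.mem_iUnion]
        refine ⟨Y ω, Finset.mem_powersetCard.2 ⟨?_, (Finset.mem_powersetCard.1 h2).2⟩, rfl⟩
        rw [show Y ω = X ω from hω]
        exact (Finset.mem_powersetCard.1 h1).1
      · exact Or.inl (Or.inr h2)
    · exact Or.inl (Or.inl h1)
  have h0 : μ {ω | Y ω = X ω} ≤ (S.card.choose (min S'.card s) : ℝ≥0∞) *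
      (S'.card.choose (min S'.card s) : ℝ≥0∞)⁻¹ := by
    refine (measure_mono hsub).trans ((measure_union_le _ _).trans ?_)
    rw [measure_union_null (hX.measure_compl_eq_zero hmX) (hY.measure_compl_eq_zero hmY), zero_add]
    refine (measure_biUnion_finset_le _ _).trans ?_
    rw [Finset.sum_congr rfl fun A hA => hY A ((Finset.mem_powersetCard.1 hA).1.trans hSS')
      (Finset.mem_powersetCard.1 hA).2, Finset.sum_const, Finset.card_powersetCard, nsmul_eq_mul]
  have hne : (S'.card.choose (min S'.card s) : ℝ≥0∞) ≠ 0 := by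
    exact_mod_cast (Nat.choose_pos (min_le_left _ _)).ne'
  refine (ENNReal.toReal_mono (ENNReal.mul_ne_top (ENNReal.natCast_ne_top _)
    (ENNReal.inv_ne_top.2 hne)) h0).trans (le_of_eq ?_)
  rw [ENNReal.toReal_mul, ENNReal.toReal_inv, ENNReal.toReal_natCast, ENNReal.toReal_natCast,
    div_eq_mul_inv]

end Sample

/-! ### Counting events and Markov-type bounds -/

/-- A bounded monotone sequence of naturals seldom increases. -/
theorem card_increase_le {M : ℕ → ℕ} (hM : Monotone M) (N B : ℕ) :
    (Finset.univ.filter fun v : Fin N => M v < M (v + 1) ∧ M v < B).card ≤ B := by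
  rw [← Finset.card_range B]
  refine Finset.card_le_card_of_injOn (fun v : Fin N => M v)
    (fun v hv => by simpa using (Finset.mem_filter.1 hv).2.2) ?_
  -- Two increases cannot start from the same value, so the values `M v < B` at which increases
  -- start are distinct.
  intro v hv v' hv' h
  have h1 := (Finset.mem_filter.1 hv).2.1
  have h2 := (Finset.mem_filter.1 hv').2.1
  simp only at h
  by_contra hne
  rcases lt_or_gt_of_ne (Fin.val_ne_of_ne hne) with hlt | hlt
  · have := hM (show (v : ℕ) + 1 ≤ v' from hlt)
    omega
  · have := hM (show (v' : ℕ) + 1 ≤ v from hlt)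
    omega

theorem sum_measureReal_eq_integral_card {Ω ι : Type*} [MeasurableSpace Ω] (μ : Measure Ω)
    [IsFiniteMeasure μ] (t : Finset ι) {G : ι → Set Ω} (hG : ∀ i ∈ t, MeasurableSet (G i)) :
    ∑ i ∈ t, μ.real (G i) = ∫ ω, ∑ i ∈ t, (G i).indicator (fun _ => (1 : ℝ)) ω ∂μ := by
  rw [integral_finsetSum _ fun i hi => (integrable_const _).indicator (hG i hi)]
  refine Finset.sum_congr rfl fun i hi => ?_
  rw [integral_indicator_const _ (hG i hi)]
  simp

theorem integrable_sum_indicator {Ω ι : Type*} [MeasurableSpace Ω] (μ : Measure Ω)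
    [IsFiniteMeasure μ] (t : Finset ι) {G : ι → Set Ω} (hG : ∀ i ∈ t, MeasurableSet (G i)) :
    Integrable (fun ω => ∑ i ∈ t, (G i).indicator (fun _ => (1 : ℝ)) ω) μ :=
  integrable_finsetSum _ fun i hi => (integrable_const _).indicator (hG i hi)

/-- The count `card_increase_le` holds for every outcome and is integrated here. It bounds how many
windows are noisy on the input that stops before the stage. -/
theorem sum_measureReal_increase_le {Ω : Type*} [MeasurableSpace Ω] (μ : Measure Ω)
    [IsProbabilityMeasure μ] {M : ℕ → Ω → ℕ} (hm : ∀ v, Measurable (M v))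
    (hM : ∀ ω, Monotone fun v => M v ω) (N B : ℕ) :
    ∑ v : Fin N, μ.real {ω | M v ω < M (v + 1) ω ∧ M v ω < B} ≤ B := by
  have hms : ∀ v : Fin N, v ∈ Finset.univ →
      MeasurableSet {ω | M v ω < M (v + 1) ω ∧ M v ω < B} := fun v _ =>
    (measurableSet_lt (hm v) (hm (v + 1))).inter (measurableSet_lt (hm v) measurable_const)
  rw [sum_measureReal_eq_integral_card μ _ hms]
  calc _ ≤ ∫ _, (B : ℝ) ∂μ := by
        refine integral_mono (integrable_sum_indicator μ _ hms) (integrable_const _) ?_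
        intro ω
        simp only [Set.indicator_apply, Set.mem_ofPred_eq, Finset.sum_boole]
        exact_mod_cast card_increase_le (hM ω) N B
    _ = B := by simp

/-- If at least `c` of the events `G i` occur whenever `A` does, then `A` has probability at most
`c⁻¹ * ∑ i, μ (G i)`. -/
theorem mul_measureReal_le_sum {Ω ι : Type*} [MeasurableSpace Ω] (μ : Measure Ω)
    [IsFiniteMeasure μ] (t : Finset ι) {G : ι → Set Ω} (hG : ∀ i ∈ t, MeasurableSet (G i))
    {A : Set Ω} (hA : MeasurableSet A) {c : ℝ}
    (h : ∀ ω ∈ A, c ≤ ∑ i ∈ t, (G i).indicator (fun _ => (1 : ℝ)) ω) :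
    c * μ.real A ≤ ∑ i ∈ t, μ.real (G i) := by
  have h1 : c * μ.real A = ∫ ω, A.indicator (fun _ => c) ω ∂μ := by
    rw [integral_indicator_const _ hA, smul_eq_mul, mul_comm]
  rw [h1, sum_measureReal_eq_integral_card μ t hG]
  refine integral_mono ((integrable_const _).indicator hA) (integrable_sum_indicator μ t hG) ?_
  intro ω
  by_cases hω : ω ∈ A
  · simpa [hω] using h ω hω
  · simp only [Set.indicator_of_notMem hω]
    exact Finset.sum_nonneg fun i _ => Set.indicator_nonneg (fun _ _ => zero_le_one) ω

/-! ### Counting arrivals and replacing blocks of rounds -/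

namespace Input

variable {k : ℕ} {α : Type*}

theorem mem_arrived {x : Input k α} {T : ℕ} {a : α} :
    a ∈ x.arrived T ↔ ∃ r < T, ∃ j, x r j = some a := by
  classical
  simp [arrived]

theorem arrived_mono {x y : Input k α} {T : ℕ}
    (h : ∀ r j a, x r j = some a → y r j = some a) : x.arrived T ⊆ y.arrived T := by
  intro a ha
  obtain ⟨r, hr, j, hj⟩ := mem_arrived.1 ha
  exact mem_arrived.2 ⟨r, hr, j, h r j a hj⟩

theorem Distinct.mono {x y : Input k α} (hy : y.Distinct)
    (h : ∀ r j a, x r j = some a → y r j = some a) : x.Distinct :=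
  fun r j r' j' a h1 h2 => hy r j r' j' a (h r j a h1) (h r' j' a h2)

theorem Distinct.card_arrived {x : Input k α} (hx : x.Distinct) (T : ℕ) :
    (x.arrived T).card =
      ∑ r ∈ Finset.range T, ∑ j : Fin k, if (x r j).isSome then 1 else 0 := by
  classical
  unfold arrived
  rw [Finset.card_biUnion]
  · refine Finset.sum_congr rfl fun r _ => ?_
    rw [Finset.card_biUnion]
    · refine Finset.sum_congr rfl fun j _ => ?_
      cases x r j <;> simp
    · intro j _ j' _ hne
      rw [Function.onFun, Finset.disjoint_left]
      intro a h1 h2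
      exact hne (hx r j r j' a (by simpa using h1) (by simpa using h2)).2
  · intro r _ r' _ hne
    rw [Function.onFun, Finset.disjoint_left]
    intro a h1 h2
    simp only [Finset.mem_biUnion, Finset.mem_univ, true_and, Option.mem_toFinset,
      Option.mem_def] at h1 h2
    obtain ⟨j, hj⟩ := h1
    obtain ⟨j', hj'⟩ := h2
    exact hne (hx r j r' j' a hj hj').1

/-- The input `x` with the rounds from `t` to `t + L` replaced by the block `b`. -/
def splice (x : Input k α) (t L : ℕ) (b : ℕ → Fin k → Option α) : Input k α :=
  fun r j => if t ≤ r ∧ r < t + L then b (r - t) j else x r j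

theorem splice_of_lt (x : Input k α) {t L r : ℕ} (b : ℕ → Fin k → Option α) (h : r < t) :
    x.splice t L b r = x r := by
  funext j
  rw [splice, if_neg (by omega)]

theorem splice_of_mem (x : Input k α) {t L r : ℕ} (b : ℕ → Fin k → Option α) (h : t ≤ r)
    (h' : r < t + L) : x.splice t L b r = b (r - t) := by
  funext j
  rw [splice, if_pos ⟨h, h'⟩]

theorem card_arrived_of_none {x : Input k α} (hx : x.Distinct) {t T : ℕ}
    (h0 : ∀ r, t ≤ r → ∀ j, x r j = none) (hT : t ≤ T) :
    (x.arrived T).card = (x.arrived t).card := by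
  obtain ⟨d, rfl⟩ := Nat.exists_eq_add_of_le hT
  rw [hx.card_arrived, hx.card_arrived, Finset.sum_range_add]
  simp [h0]

theorem card_arrived_splice {x : Input k α} {t L c : ℕ} {b : ℕ → Fin k → Option α}
    (hx : x.Distinct) (hxs : (x.splice t L b).Distinct)
    (hb : ∀ ℓ < L, (∑ j : Fin k, if (b ℓ j).isSome then 1 else 0) = c) :
    ((x.splice t L b).arrived (t + L)).card = (x.arrived t).card + c * L := by
  rw [hxs.card_arrived, hx.card_arrived, Finset.sum_range_add]
  congr 1
  · refine Finset.sum_congr rfl fun r hr => ?_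
    rw [splice_of_lt x b (Finset.mem_range.1 hr)]
  · rw [Finset.sum_congr rfl fun ℓ hℓ => ?_, Finset.sum_const, Finset.card_range, smul_eq_mul,
      mul_comm]
    rw [splice_of_mem x b (by omega) (by simpa using hℓ), Nat.add_sub_cancel_left]
    exact hb ℓ (Finset.mem_range.1 hℓ)

end Input

/-! ### Inputs built from stages and windows -/

/-- A plan for an input that arrives in stages: in stage `i`, each of the first `sites i` sites
observes `len i` elements, one in each of `len i` consecutive rounds. These rounds are one of
`slots` disjoint windows that make up the stage. -/
structure Schedule (α : Type*) where
  sites : ℕ → ℕ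
  len : ℕ → ℕ
  item : ℕ → α
  slots : ℕ

namespace Schedule

variable {k : ℕ} {α : Type*} (Q : Schedule α)

/-- The number of elements that arrive before stage `i`. -/
def before (i : ℕ) : ℕ := ∑ i' ∈ Finset.range i, Q.sites i' * Q.len i'

/-- The first round of stage `i`. -/
def stageStart (i : ℕ) : ℕ := ∑ i' ∈ Finset.range i, Q.slots * Q.len i'

/-- The first round of window `v` of stage `i`. -/
def windowStart (i v : ℕ) : ℕ := Q.stageStart i + v * Q.len i

/-- The observations in the window of stage `i`. -/
def block (k i : ℕ) (ℓ : ℕ) (j : Fin k) : Option α :=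
  if (j : ℕ) < Q.sites i then some (Q.item (Q.before i + j * Q.len i + ℓ)) else none

/-- The first `i` stages, using the windows `w`. -/
def input (k : ℕ) (w : ℕ → ℕ) : ℕ → Input k α
  | 0 => fun _ _ => none
  | i + 1 => (input k w i).splice (Q.windowStart i (w i)) (Q.len i) (Q.block k i)

theorem before_succ (i : ℕ) : Q.before (i + 1) = Q.before i + Q.sites i * Q.len i :=
  Finset.sum_range_succ _ _

theorem before_mono : Monotone Q.before := fun _ _ h =>
  Finset.sum_le_sum_of_subset (Finset.range_mono h)

theorem stageStart_mono : Monotone Q.stageStart := fun _ _ h =>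
  Finset.sum_le_sum_of_subset (Finset.range_mono h)

theorem stageStart_le_windowStart (i v : ℕ) : Q.stageStart i ≤ Q.windowStart i v :=
  Nat.le_add_right _ _

theorem windowStart_succ (i v : ℕ) : Q.windowStart i (v + 1) = Q.windowStart i v + Q.len i := by
  simp only [windowStart]; ring

theorem windowStart_add_len_le {i v : ℕ} (hv : v < Q.slots) :
    Q.windowStart i v + Q.len i ≤ Q.stageStart (i + 1) := by
  rw [← windowStart_succ, windowStart, stageStart, stageStart, Finset.sum_range_succ]
  gcongr
  omega

variable {Q} {w : ℕ → ℕ}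

theorem input_congr {w' : ℕ → ℕ} {i : ℕ} (h : ∀ i' < i, w i' = w' i') :
    Q.input k w i = Q.input k w' i := by
  induction i with
  | zero => rfl
  | succ i ih => rw [input, input, ih fun i' hi' => h i' (by omega), h i (by omega)]

theorem input_eq_none (hw : ∀ i, w i < Q.slots) {i r : ℕ} (hr : Q.stageStart i ≤ r) (j : Fin k) :
    Q.input k w i r j = none := by
  induction i with
  | zero => rfl
  | succ i ih =>
    have h1 := Q.windowStart_add_len_le (hw i) (i := i)
    rw [input, Input.splice, if_neg (by omega)]
    exact ih ((Q.stageStart_mono (Nat.le_succ i)).trans hr)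

/-- Stage `i` and all later ones change only rounds from `Q.windowStart i (w i)` on. Thus the whole
input and its truncation before stage `i` agree up to the window of that stage. -/
theorem input_eq_of_lt_windowStart (hw : ∀ i, w i < Q.slots) {i I r : ℕ} (hiI : i ≤ I)
    (hr : r < Q.windowStart i (w i)) : Q.input k w I r = Q.input k w i r := by
  induction I, hiI using Nat.le_induction with
  | base => rfl
  | succ I hiI ih =>
    rw [input, Input.splice_of_lt, ih]
    rcases hiI.eq_or_lt with rfl | hlt
    · exact hr
    · have h1 := Q.windowStart_add_len_le (hw i) (i := i)
      have h2 := Q.stageStart_mono (show i + 1 ≤ I from hlt)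
      have h3 := Q.stageStart_le_windowStart I (w I)
      omega

theorem input_eq_block (hw : ∀ i, w i < Q.slots) {i I r : ℕ} (hiI : i < I)
    (hr : Q.windowStart i (w i) ≤ r) (hr' : r < Q.windowStart i (w i) + Q.len i) :
    Q.input k w I r = Q.block k i (r - Q.windowStart i (w i)) := by
  have h1 := Q.windowStart_add_len_le (hw i) (i := i)
  have h3 := Q.stageStart_le_windowStart (i + 1) (w (i + 1))
  rw [input_eq_of_lt_windowStart hw (show i + 1 ≤ I from hiI) (by omega), input,
    Input.splice_of_mem _ _ hr hr']

theorem exists_of_input_eq_some {i r : ℕ} {j : Fin k} {a : α} (h : Q.input k w i r j = some a) :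
    ∃ i' < i, Q.windowStart i' (w i') ≤ r ∧ r < Q.windowStart i' (w i') + Q.len i' ∧
      (j : ℕ) < Q.sites i' ∧
      a = Q.item (Q.before i' + (j * Q.len i' + (r - Q.windowStart i' (w i')))) := by
  induction i with
  | zero => simp [input] at h
  | succ i ih =>
    rw [input, Input.splice] at h
    split_ifs at h with hc
    · rw [block] at h
      split_ifs at h with hj
      exact ⟨i, by omega, hc.1, hc.2, hj, by rw [← add_assoc]; exact (Option.some.inj h).symm⟩
    · obtain ⟨i', h1, h2⟩ := ih h
      exact ⟨i', by omega, h2⟩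

theorem mul_len_add_lt {c j L ℓ : ℕ} (hj : j < c) (hℓ : ℓ < L) : j * L + ℓ < c * L := by
  calc j * L + ℓ < (j + 1) * L := by rw [add_mul, one_mul]; omega
    _ ≤ c * L := Nat.mul_le_mul_right L hj

/-- The index of an element encodes stage, site and offset in the window as digits in a mixed radix,
so the index determines the round and the site. -/
theorem input_distinct {I : ℕ} (hitem : Set.InjOn Q.item (Set.Iio (Q.before I))) :
    (Q.input k w I).Distinct := by
  intro r j r' j' a h h'
  obtain ⟨i, hi, h1, h2, h3, h4⟩ := exists_of_input_eq_some h
  obtain ⟨i', hi', h1', h2', h3', h4'⟩ := exists_of_input_eq_some h'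
  have hb := mul_len_add_lt h3 (show r - Q.windowStart i (w i) < Q.len i by omega)
  have hb' := mul_len_add_lt h3' (show r' - Q.windowStart i' (w i') < Q.len i' by omega)
  have e := Q.before_succ i
  have e' := Q.before_succ i'
  have l := Q.before_mono (show i + 1 ≤ I from hi)
  have l' := Q.before_mono (show i' + 1 ≤ I from hi')
  have key := hitem (by rw [Set.mem_Iio]; omega) (by rw [Set.mem_Iio]; omega) (h4.symm.trans h4')
  have hii : i = i' := by
    by_contra hne
    rcases lt_or_gt_of_ne hne with hlt | hlt
    · have := Q.before_mono (show i + 1 ≤ i' from hlt)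
      omega
    · have := Q.before_mono (show i' + 1 ≤ i from hlt)
      omega
  subst hii
  have key' := Nat.add_left_cancel key
  have hjj : (j : ℕ) = j' := by
    by_contra hne
    rcases lt_or_gt_of_ne hne with hlt | hlt
    · have := mul_len_add_lt hlt (show r - Q.windowStart i (w i) < Q.len i by omega)
      omega
    · have := mul_len_add_lt hlt (show r' - Q.windowStart i (w i) < Q.len i by omega)
      omega
  rw [hjj] at key'
  exact ⟨by omega, Fin.ext hjj⟩

theorem sum_block (i ℓ : ℕ) (hs : Q.sites i ≤ k) :
    (∑ j : Fin k, if (Q.block k i ℓ j).isSome then 1 else 0) = Q.sites i := by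
  have : ∀ j : Fin k, (Q.block k i ℓ j).isSome = true ↔ (j : ℕ) < Q.sites i := by
    intro j; rw [block]; split_ifs with h <;> simp [h]
  simp only [this, Finset.sum_boole]
  rw [Fin.card_filter_val_lt]
  simpa using hs

theorem card_arrived_input (hw : ∀ i, w i < Q.slots) {I T : ℕ}
    (hitem : Set.InjOn Q.item (Set.Iio (Q.before I))) (hs : ∀ i < I, Q.sites i ≤ k)
    (hT : Q.stageStart I ≤ T) : ((Q.input k w I).arrived T).card = Q.before I := by
  induction I generalizing T with
  | zero =>
    rw [(input_distinct hitem).card_arrived]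
    simp [input, before]
  | succ I ih =>
    have hitem' : Set.InjOn Q.item (Set.Iio (Q.before I)) :=
      hitem.mono (Set.Iio_subset_Iio (Q.before_mono (Nat.le_succ I)))
    have h1 := Q.windowStart_add_len_le (hw I) (i := I)
    have hd := input_distinct (k := k) (w := w) hitem
    rw [Input.card_arrived_of_none hd (t := Q.windowStart I (w I) + Q.len I) ?_ (by omega),
      input, Input.card_arrived_splice (input_distinct hitem') hd
        fun ℓ _ => sum_block I ℓ (hs I (by omega)),
      ih hitem' (fun i hi => hs i (by omega)) (Q.stageStart_le_windowStart _ _), before_succ]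
    intro r hr j
    rw [input, Input.splice, if_neg (by omega)]
    exact input_eq_none hw (by have := Q.stageStart_le_windowStart I (w I); omega) j

end Schedule

/-! ### The probability that an active link stays silent -/

/-- No message is sent over the link of site `j` in the `L` rounds from round `t` on. -/
def Protocol.LinkSilent {k : ℕ} {α Ω U D : Type*} (P : Protocol k α Ω U D) (ω : Ω)
    (x : Input k α) (t L : ℕ) (j : Fin k) : Prop :=
  ∀ r, t ≤ r → r < t + L → P.up ω x r j = none ∧ P.down ω x r j = none

theorem Protocol.IsMeasurable.measurableSet_linkSilent {k : ℕ} {α Ω U D : Type*}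
    [MeasurableSpace Ω] {P : Protocol k α Ω U D} (hP : P.IsMeasurable) (x : Input k α) (t L : ℕ) (j : Fin k) :
    MeasurableSet {ω | P.LinkSilent ω x t L j} := by
  have h : {ω | P.LinkSilent ω x t L j} = ⋂ r ∈ Set.Ico t (t + L),
      ({ω | (P.up ω x r j).isSome}ᶜ ∩ {ω | (P.down ω x r j).isSome}ᶜ) := by
    ext ω
    simp [Protocol.LinkSilent, Set.mem_iInter]
  rw [h]
  exact MeasurableSet.biInter (Set.to_countable _) fun r _ =>
    (hP.up x r j).compl.inter (hP.down x r j).compl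

namespace Schedule

variable {k : ℕ} {α Ω U D : Type*} [MeasurableSpace Ω] {μ : Measure Ω} [IsProbabilityMeasure μ]
  {P : Protocol k α Ω U D} {Q : Schedule α} {w : ℕ → ℕ} {s : ℕ}

/-- A site that observes enough new elements in a window is silent there only if its elements are
missing from the sample, or if the window is one in which a message would have been sent anyway. -/
theorem measureReal_linkSilent_le (hw : ∀ i, w i < Q.slots) {I i T : ℕ} (hi : i < I)
    (hitem : Set.InjOn Q.item (Set.Iio (Q.before I))) (hs : ∀ i < I, Q.sites i ≤ k)
    (hP : P.IsMeasurable) (hc : P.Correct μ s) (hlen : 0 < Q.len i) {j : Fin k}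
    (hj : (j : ℕ) < Q.sites i) (hT : Q.windowStart i (w i) + Q.len i ≤ T) (B : ℕ) :
    μ.real {ω | P.LinkSilent ω (Q.input k w I) (Q.windowStart i (w i)) (Q.len i) j ∧
        P.messages ω (Q.input k w I) T < B} ≤
      ((Q.before i).choose (min (Q.before i + Q.len i) s) : ℝ) /
        ((Q.before i + Q.len i).choose (min (Q.before i + Q.len i) s) : ℝ) +
      μ.real {ω | P.messages ω (Q.input k w i) (Q.windowStart i (w i)) <
          P.messages ω (Q.input k w i) (Q.windowStart i (w i + 1)) ∧
        P.messages ω (Q.input k w i) (Q.windowStart i (w i)) < B} := by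
  set t := Q.windowStart i (w i) with ht
  set L := Q.len i with hL
  set x := Q.input k w i with hx
  set z := Q.input k w I with hz
  -- The hybrid input: in the window, site `j` sees what it sees in `z`, and every other site sees
  -- nothing, as in `x`.
  set b : ℕ → Fin k → Option α := fun ℓ j' => if j' = j then Q.block k i ℓ j' else none with hb
  set y := x.splice t L b with hy
  have hxz : ∀ r < t, x r = z r := fun r hr => (input_eq_of_lt_windowStart hw hi.le hr).symm
  have hx0 : ∀ r, t ≤ r → ∀ j, x r j = none := fun r hr j =>
    input_eq_none hw ((Q.stageStart_le_windowStart _ _).trans hr) j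
  have hzb : ∀ r, t ≤ r → r < t + L → z r = Q.block k i (r - t) := fun r h1 h2 =>
    input_eq_block hw hi h1 h2
  have hzd : z.Distinct := input_distinct hitem
  have hxy' : ∀ r j a, x r j = some a → y r j = some a := by
    intro r j a h
    have hr : r < t := by
      by_contra hr
      rw [hx0 r (by omega)] at h
      simp at h
    rw [hy, Input.splice_of_lt _ _ hr, h]
  have hyz' : ∀ r j a, y r j = some a → z r j = some a := by
    intro r j' a h
    rw [hy, Input.splice] at h
    split_ifs at h with hr
    · rw [hzb r hr.1 hr.2]
      simp only [hb] at h
      split_ifs at h with hjj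
      exact h
    · by_cases hr' : r < t
      · rwa [← hxz r hr']
      · rw [hx0 r (by omega)] at h
        simp at h
  have hyd : y.Distinct := hzd.mono hyz'
  have hxd : x.Distinct := hyd.mono hxy'
  -- `R` is the last round of the window; the samples on `x` and `y` are compared at its end.
  obtain ⟨R, hR⟩ : ∃ R, t + L = R + 1 := ⟨t + L - 1, by omega⟩
  have hitem' : Set.InjOn Q.item (Set.Iio (Q.before i)) :=
    hitem.mono (Set.Iio_subset_Iio (Q.before_mono hi.le))
  have hs' : ∀ i' < i, Q.sites i' ≤ k := fun i' hi' => hs i' (by omega)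
  have hcx : (x.arrived (R + 1)).card = Q.before i := by
    rw [← hR]
    exact card_arrived_input hw hitem' hs'
      ((Q.stageStart_le_windowStart i (w i)).trans (Nat.le_add_right _ _))
  have hcy : (y.arrived (R + 1)).card = Q.before i + L := by
    rw [← hR, hy, Input.card_arrived_splice hxd hyd (c := 1), one_mul,
      card_arrived_input hw hitem' hs' (Q.stageStart_le_windowStart i (w i))]
    intro ℓ _
    rw [Finset.sum_eq_single j]
    · simp [hb, block, hj]
    · intro j' _ hne
      simp [hb, hne]
    · simp
  have hsample := (hc x hxd R).measureReal_eq_le (hc y hyd R) (Input.arrived_mono hxy')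
    (hP.sample x R) (hP.sample y R)
  rw [hcx, hcy] at hsample
  refine le_trans ?_ (add_le_add_left hsample _)
  refine le_trans (measureReal_mono ?_) (measureReal_union_le _ _)
  rintro ω ⟨h1, h2⟩
  have hzt : P.messages ω z t = P.messages ω x t :=
    (P.messages_congr ω hxz).symm
  -- Either the run on `x` is noisy in this window, which is the second summand, or it is silent and
  -- the samples on `x` and `y` coincide, which is the first.
  by_cases hsil : P.messages ω x t < P.messages ω x (Q.windowStart i (w i + 1))
  · refine Or.inr ⟨hsil, ?_⟩
    rw [← hzt]
    exact (P.messages_mono ω z (by omega)).trans_lt h2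
  · refine Or.inl ?_
    rw [windowStart_succ, not_lt] at hsil
    change P.sample ω (P.run ω y (R + 1)).2 = P.sample ω (P.run ω x (R + 1)).2
    rw [← hR, P.run_snd_eq_of_silent (x := x) (y := y) (z := z) (t := t) (j := j) (R := t + L)
      (fun r hr => Input.splice_of_lt _ _ hr)
      (fun r hr => (Input.splice_of_lt _ _ hr).trans (hxz r hr)) ?_ ?_
      (fun r h3 h4 i' => P.silent_of_messages_eq hsil h3 h4 i') h1 (Nat.le_add_right _ _)]
    · intro r h3 h4 i' hne
      rw [hx0 r h3, hy, Input.splice_of_mem _ _ h3 h4]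
      simp [hb, hne]
    · intro r h3 h4
      rw [hzb r h3 h4, hy, Input.splice_of_mem _ _ h3 h4]
      simp [hb]

/-- A choice of windows for the first `I` stages, continued by zero. -/
def extend {I N : ℕ} (u : Fin I → Fin N) (i : ℕ) : ℕ := if h : i < I then (u ⟨i, h⟩ : ℕ) else 0

theorem extend_lt {I N : ℕ} (hN : 0 < N) (u : Fin I → Fin N) (i : ℕ) : extend u i < N := by
  rw [extend]
  split_ifs
  · exact Fin.is_lt _
  · exact hN

theorem extend_apply {I N : ℕ} (u : Fin I → Fin N) (i : Fin I) : extend u i = u i := by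
  simp [extend]

/-- To bound a sum over all choices of windows, fix all of them but one. -/
theorem sum_le_of_sum_update_le {I N : ℕ} (i : Fin I) (g : (Fin I → Fin N) → ℝ) {B : ℝ}
    (h : ∀ u, ∑ v, g (Function.update u i v) ≤ B) : N * ∑ u, g u ≤ N ^ I * B := by
  have h1 : ∑ u : Fin I → Fin N, ∑ v, g (Function.update u i v) = N * ∑ u, g u := by
    rw [Finset.sum_comm]
    -- Overwriting coordinate `i` by `c` reaches each `u` with `u i = c` exactly `N` times.
    have h2 : ∀ c : Fin N, ∑ u, g (Function.update u i c) =
        N * ∑ u : Fin I → Fin N, if u i = c then g u else 0 := by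
      intro c
      rw [← (Equiv.funSplitAt i (Fin N)).symm.sum_comp, ← (Equiv.funSplitAt i (Fin N)).symm.sum_comp,
        Fintype.sum_prod_type, Fintype.sum_prod_type]
      have h3 : ∀ (a : Fin N) (f : {j // j ≠ i} → Fin N),
          Function.update ((Equiv.funSplitAt i (Fin N)).symm (a, f)) i c =
            (Equiv.funSplitAt i (Fin N)).symm (c, f) := by
        intro a f
        ext j
        by_cases hj : j = i
        · subst hj; simp [Equiv.funSplitAt, Equiv.piSplitAt]
        · simp [Equiv.funSplitAt, Equiv.piSplitAt, hj]
      have h4 : ∀ (a : Fin N) (f : {j // j ≠ i} → Fin N),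
          (Equiv.funSplitAt i (Fin N)).symm (a, f) i = a := by
        intro a f
        simp [Equiv.funSplitAt, Equiv.piSplitAt]
      simp only [h3, h4]
      rw [Finset.sum_const, Finset.card_univ, Fintype.card_fin, nsmul_eq_mul,
        Finset.sum_eq_single c]
      · simp
      · intro a _ ha
        simp [ha]
      · simp
    simp only [h2]
    rw [← Finset.mul_sum, Finset.sum_comm]
    simp
  rw [← h1]
  refine (Finset.sum_le_sum fun u _ => h u).trans (le_of_eq ?_)
  simp

/-- One `δ` pays for a sample that misses the new block; the other pays for a window noisy on the
truncated input, a fraction of at most `B / Q.slots` of the windows on average. -/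
theorem sum_measureReal_linkSilent_le {I T : ℕ} (hN : 0 < Q.slots) (i : Fin I)
    (hitem : Set.InjOn Q.item (Set.Iio (Q.before I))) (hs : ∀ i < I, Q.sites i ≤ k)
    (hP : P.IsMeasurable) (hc : P.Correct μ s) (hlen : 0 < Q.len i) {j : Fin k}
    (hj : (j : ℕ) < Q.sites i) (hT : Q.stageStart I ≤ T) (B : ℕ) {δ : ℝ}
    (hδ : ((Q.before i).choose (min (Q.before i + Q.len i) s) : ℝ) ≤
        δ * ((Q.before i + Q.len i).choose (min (Q.before i + Q.len i) s) : ℝ))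
    (hB : B ≤ δ * Q.slots) :
    ∑ u : Fin I → Fin Q.slots,
      μ.real {ω | P.LinkSilent ω (Q.input k (extend u) I) (Q.windowStart i (extend u i)) (Q.len i) j ∧
        P.messages ω (Q.input k (extend u) I) T < B} ≤ Q.slots ^ I * (2 * δ) := by
  have hN' : (0 : ℝ) < Q.slots := by exact_mod_cast hN
  set g : (Fin I → Fin Q.slots) → ℝ := fun u =>
    μ.real {ω | P.messages ω (Q.input k (extend u) i) (Q.windowStart i (extend u i)) <
          P.messages ω (Q.input k (extend u) i) (Q.windowStart i (extend u i + 1)) ∧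
        P.messages ω (Q.input k (extend u) i) (Q.windowStart i (extend u i)) < B} with hg
  have hstage : ∀ u : Fin I → Fin Q.slots, _ ≤ δ + g u := fun u =>
    (measureReal_linkSilent_le (T := T) (extend_lt hN u) i.2 hitem hs hP hc hlen hj
      ((Q.windowStart_add_len_le (extend_lt hN u i)).trans
        ((Q.stageStart_mono (Nat.succ_le_of_lt i.2)).trans hT)) B).trans
      (add_le_add_left ((div_le_iff₀ (by
        exact_mod_cast Nat.choose_pos (min_le_left _ _))).2 hδ) _)
  refine (Finset.sum_le_sum fun u _ => hstage u).trans ?_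
  have hsum : Q.slots * ∑ u, g u ≤ Q.slots ^ I * B := by
    refine sum_le_of_sum_update_le i g fun u => ?_
    -- The truncated input does not depend on the window of stage `i`, so as `v` varies a single run
    -- is inspected in all windows.
    have hinp : ∀ v, Q.input k (extend (Function.update u i v)) i = Q.input k (extend u) i := by
      intro v
      refine input_congr fun i' hi' => ?_
      have hlt : i' < I := hi'.trans i.2
      have hne : (⟨i', hlt⟩ : Fin I) ≠ i := fun h => by
        rw [← h] at hi'
        simp at hi'
      simp [extend, hlt, hne]
    have hval : ∀ v, extend (Function.update u i v) i = (v : ℕ) := by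
      intro v
      simp [extend_apply]
    simp only [hg, hinp, hval]
    exact sum_measureReal_increase_le μ
      (M := fun v ω => P.messages ω (Q.input k (extend u) i) (Q.windowStart i v))
      (fun v => hP.measurable_messages _ _)
      (fun ω v v' h => P.messages_mono ω _ (by
        simp only [windowStart]
        gcongr)) _ _
  have hsum' : ∑ u, g u ≤ Q.slots ^ I * δ := by
    refine le_of_mul_le_mul_left (hsum.trans ?_) hN'
    calc (Q.slots : ℝ) ^ I * B ≤ Q.slots ^ I * (δ * Q.slots) := by gcongr
      _ = _ := by ring
  rw [Finset.sum_add_distrib]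
  simp only [Finset.sum_const, Finset.card_univ, Fintype.card_fun, Fintype.card_fin, nsmul_eq_mul,
    Nat.cast_pow]
  linarith

end Schedule

/-! ### From silent links to few messages -/

namespace Schedule

variable {k : ℕ} {α Ω U D : Type*} {P : Protocol k α Ω U D} {Q : Schedule α} {s : ℕ}

theorem stage_eq_of_mem_windows {w : ℕ → ℕ} (hw : ∀ i, w i < Q.slots) {i i' r : ℕ}
    (h1 : Q.windowStart i (w i) ≤ r) (h2 : r < Q.windowStart i (w i) + Q.len i)
    (h1' : Q.windowStart i' (w i') ≤ r) (h2' : r < Q.windowStart i' (w i') + Q.len i') :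
    i = i' := by
  have a1 := Q.windowStart_add_len_le (hw i) (i := i)
  have a1' := Q.windowStart_add_len_le (hw i') (i := i')
  have a2 := Q.stageStart_le_windowStart i (w i)
  have a2' := Q.stageStart_le_windowStart i' (w i')
  by_contra hne
  rcases lt_or_gt_of_ne hne with hlt | hlt
  · have := Q.stageStart_mono (show i + 1 ≤ i' from hlt)
    omega
  · have := Q.stageStart_mono (show i' + 1 ≤ i from hlt)
    omega

open Classical in
/-- Each pair of a stage and a site whose link is not silent in the window of this stage accounts
for a message of its own. -/
theorem card_not_linkSilent_le {w : ℕ → ℕ} (hw : ∀ i, w i < Q.slots) (ω : Ω) (z : Input k α)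
    {E T : ℕ} (hT : Q.stageStart E ≤ T) :
    (Finset.univ.filter fun p : Fin E × Fin k =>
      ¬ P.LinkSilent ω z (Q.windowStart p.1 (w p.1)) (Q.len p.1) p.2).card ≤
      P.messages ω z T := by
  set c : ℕ × Fin k → ℕ := fun p => (if (P.up ω z p.1 p.2).isSome then 1 else 0) +
    (if (P.down ω z p.1 p.2).isSome then 1 else 0) with hc
  have hm : P.messages ω z T = ∑ p ∈ Finset.range T ×ˢ (Finset.univ : Finset (Fin k)), c p := by
    rw [Finset.sum_product]
    rfl
  have hex : ∀ p : Fin E × Fin k, ∃ r : ℕ,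
      ¬ P.LinkSilent ω z (Q.windowStart p.1 (w p.1)) (Q.len p.1) p.2 →
        Q.windowStart p.1 (w p.1) ≤ r ∧ r < Q.windowStart p.1 (w p.1) + Q.len p.1 ∧
          c (r, p.2) ≠ 0 := by
    intro p
    by_cases hp : P.LinkSilent ω z (Q.windowStart p.1 (w p.1)) (Q.len p.1) p.2
    · exact ⟨0, fun h => absurd hp h⟩
    · have hp' := hp
      simp only [Protocol.LinkSilent, not_forall] at hp'
      obtain ⟨r, h1, h2, h3⟩ := hp'
      refine ⟨r, fun _ => ⟨h1, h2, fun h0 => h3 ?_⟩⟩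
      simpa [hc] using h0
  choose r hr using hex
  calc _ ≤ ((Finset.range T ×ˢ (Finset.univ : Finset (Fin k))).filter fun p => c p ≠ 0).card := by
        refine Finset.card_le_card_of_injOn (fun p => (r p, p.2)) ?_ ?_
        · intro p hp
          obtain ⟨h1, h2, h3⟩ := hr p (Finset.mem_filter.1 hp).2
          have a1 := Q.windowStart_add_len_le (hw p.1) (i := p.1)
          have a2 := Q.stageStart_mono (Nat.succ_le_of_lt p.1.2)
          rw [Nat.succ_eq_add_one] at a2
          refine Finset.mem_coe.2 (Finset.mem_filter.2 ⟨Finset.mem_product.2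
            ⟨Finset.mem_range.2 ?_, Finset.mem_univ _⟩, h3⟩)
          simp only
          omega
        · intro p hp p' hp' h
          obtain ⟨h1, h2, -⟩ := hr p (Finset.mem_filter.1 hp).2
          obtain ⟨h1', h2', -⟩ := hr p' (Finset.mem_filter.1 hp').2
          simp only [Prod.mk.injEq] at h
          rw [← h.1] at h1' h2'
          exact Prod.ext (Fin.ext (stage_eq_of_mem_windows hw h1 h2 h1' h2')) h.2
    _ ≤ ∑ p ∈ (Finset.range T ×ˢ (Finset.univ : Finset (Fin k))).filter (fun p => c p ≠ 0), c p := by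
        rw [Finset.card_eq_sum_ones]
        exact Finset.sum_le_sum fun p hp =>
          Nat.one_le_iff_ne_zero.2 (Finset.mem_filter.1 hp).2
    _ = P.messages ω z T := by rw [hm, Finset.sum_filter_ne_zero]

theorem card_pairs {E : ℕ} (hs : ∀ i < E, Q.sites i ≤ k) :
    (Finset.univ.filter fun p : Fin E × Fin k => (p.2 : ℕ) < Q.sites p.1).card =
      ∑ i ∈ Finset.range E, Q.sites i := by
  rw [Finset.card_filter, ← Finset.univ_product_univ, Finset.sum_product,
    ← Fin.sum_univ_eq_sum_range]
  refine Finset.sum_congr rfl fun i _ => ?_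
  rw [← Finset.card_filter]
  simp only
  rw [Fin.card_filter_val_lt]
  simpa using hs i i.2

/-- On average over the choice of the windows, few messages are unlikely. -/
theorem sum_measureReal_messages_ge [MeasurableSpace Ω] {μ : Measure Ω} [IsProbabilityMeasure μ]
    {E T : ℕ} (hN : 0 < Q.slots)
    (hitem : Set.InjOn Q.item (Set.Iio (Q.before (E + 1)))) (hs : ∀ i < E + 1, Q.sites i ≤ k)
    (hP : P.IsMeasurable) (hc : P.Correct μ s) (hlen : ∀ i < E, 0 < Q.len i)
    (hT : Q.stageStart (E + 1) ≤ T) {δ : ℝ}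
    (hδ : ∀ i < E, ((Q.before i).choose (min (Q.before i + Q.len i) s) : ℝ) ≤
        δ * ((Q.before i + Q.len i).choose (min (Q.before i + Q.len i) s) : ℝ)) (hδ0 : 0 ≤ δ)
    (hB : ((∑ i ∈ Finset.range E, Q.sites i : ℕ) : ℝ) ≤ δ * Q.slots) :
    Q.slots ^ (E + 1) * (1 - 4 * δ) ≤ ∑ u : Fin (E + 1) → Fin Q.slots,
      μ.real {ω | ∑ i ∈ Finset.range E, Q.sites i ≤
        2 * P.messages ω (Q.input k (extend u) (E + 1)) T} := by
  classical
  set K := ∑ i ∈ Finset.range E, Q.sites i with hK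
  set z : (Fin (E + 1) → Fin Q.slots) → Input k α := fun u => Q.input k (extend u) (E + 1) with hz
  set A : (Fin (E + 1) → Fin Q.slots) → Set Ω := fun u => {ω | 2 * P.messages ω (z u) T < K} with hA
  have hmA : ∀ u, MeasurableSet (A u) := fun u =>
    measurableSet_lt ((hP.measurable_messages (z u) T).const_mul 2) measurable_const
  have hcompl : ∀ u, {ω | K ≤ 2 * P.messages ω (z u) T} = (A u)ᶜ := by
    intro u
    ext ω
    simp [hA]
  set t := Finset.univ.filter fun p : Fin E × Fin k => (p.2 : ℕ) < Q.sites p.1 with ht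
  have htK : t.card = K := card_pairs fun i hi => hs i (by omega)
  set G : (Fin (E + 1) → Fin Q.slots) → Fin E × Fin k → Set Ω := fun u p =>
    {ω | P.LinkSilent ω (z u) (Q.windowStart p.1 (extend u p.1)) (Q.len p.1) p.2 ∧
      P.messages ω (z u) T < K} with hG
  have hmG : ∀ u p, MeasurableSet (G u p) := fun u p =>
    (hP.measurableSet_linkSilent _ _ _ _).inter
      (measurableSet_lt (hP.measurable_messages (z u) T) measurable_const)
  -- Fewer than `K / 2` messages break the silence of fewer than `K / 2` of the `K` pairs, so at
  -- least `K / 2` of the events `G u p` occur on `A u`.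
  have hmarkov : ∀ u, (K / 2 : ℝ) * μ.real (A u) ≤ ∑ p ∈ t, μ.real (G u p) := by
    intro u
    refine mul_measureReal_le_sum μ t (fun p _ => hmG u p) (hmA u) fun ω hω => ?_
    have hω' : 2 * P.messages ω (z u) T < K := hω
    simp only [Set.indicator_apply, hG, Set.mem_ofPred_eq, Finset.sum_boole]
    have h1 := card_not_linkSilent_le (P := P) (extend_lt hN u) ω (z u) (E := E) (T := T)
      ((Q.stageStart_mono (Nat.le_succ E)).trans hT)
    have h2 := Finset.card_filter_add_card_filter_not (s := t) (fun p =>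
      P.LinkSilent ω (z u) (Q.windowStart p.1 (extend u p.1)) (Q.len p.1) p.2)
    have h3 : (t.filter fun p =>
        ¬ P.LinkSilent ω (z u) (Q.windowStart p.1 (extend u p.1)) (Q.len p.1) p.2).card ≤
        P.messages ω (z u) T :=
      (Finset.card_le_card (Finset.filter_subset_filter _ (Finset.subset_univ t))).trans h1
    have h4 : (t.filter fun p =>
        P.LinkSilent ω (z u) (Q.windowStart p.1 (extend u p.1)) (Q.len p.1) p.2 ∧
          P.messages ω (z u) T < K) = t.filter fun p =>
        P.LinkSilent ω (z u) (Q.windowStart p.1 (extend u p.1)) (Q.len p.1) p.2 :=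
      Finset.filter_congr fun p _ => and_iff_left (by omega)
    rw [h4, div_le_iff₀ two_pos]
    norm_cast
    omega
  have hsum : (K / 2 : ℝ) * ∑ u, μ.real (A u) ≤ (K / 2 : ℝ) * (Q.slots ^ (E + 1) * (4 * δ)) := by
    rw [Finset.mul_sum]
    refine (Finset.sum_le_sum fun u _ => hmarkov u).trans ?_
    rw [Finset.sum_comm]
    calc _ ≤ ∑ p ∈ t, (Q.slots : ℝ) ^ (E + 1) * (2 * δ) := by
          refine Finset.sum_le_sum fun p hp => ?_
          -- Only the first `E` stages are counted; stage `E` is filler that brings the number of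
          -- elements to `n`.
          exact sum_measureReal_linkSilent_le (i := p.1.castSucc) hN hitem hs hP hc (hlen p.1 p.1.2)
            (Finset.mem_filter.1 hp).2 hT K (hδ p.1 p.1.2) hB
      _ = _ := by
          rw [Finset.sum_const, htK, nsmul_eq_mul]
          ring
  have hsumA : ∑ u, μ.real (A u) ≤ Q.slots ^ (E + 1) * (4 * δ) := by
    rcases Nat.eq_zero_or_pos K with h0 | hpos
    · have : ∀ u, A u = ∅ := by
        intro u
        ext ω
        simp [hA, h0]
      simp only [this, measureReal_empty, Finset.sum_const_zero]
      positivity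
    · exact le_of_mul_le_mul_left hsum (by positivity)
  rw [Finset.sum_congr rfl fun u _ => (congrArg μ.real (hcompl u)).trans
    (probReal_compl_eq_one_sub (hmA u)), Finset.sum_sub_distrib]
  simp only [Finset.sum_const, Finset.card_univ, Fintype.card_fun, Fintype.card_fin, nsmul_eq_mul,
    Nat.cast_pow]
  linarith

end Schedule

/-! ### Binomial estimates and the choice of the stages -/

/-- The left side counts the `(s + 1)`-subsets with at most one of the `L` new elements. -/
theorem choose_add_mul_choose_le (m s L : ℕ) :
    m.choose (s + 1) + L * m.choose s ≤ (m + L).choose (s + 1) := by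
  induction L with
  | zero => simp
  | succ L ih =>
    rw [← add_assoc, Nat.choose_succ_succ']
    have := Nat.choose_le_choose s (Nat.le_add_right m L)
    rw [add_mul, one_mul]
    omega

/-- A sample of size `s` from `m + L` elements misses the last `L` of them with probability at most
`1 / (A + 1)`. -/
theorem mul_choose_le_choose_add {A m s L : ℕ} (hs : 1 ≤ s) (hL : A * m ≤ s * L) :
    (A + 1) * m.choose s ≤ (m + L).choose s := by
  obtain ⟨s, rfl⟩ := Nat.exists_eq_add_of_le' hs
  refine le_trans ?_ (choose_add_mul_choose_le m s L)
  have h1 : A * m.choose (s + 1) ≤ L * m.choose s := by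
    refine Nat.le_of_mul_le_mul_left ?_ (Nat.succ_pos s)
    calc (s + 1) * (A * m.choose (s + 1)) = A * (m.choose (s + 1) * (s + 1)) := by ring
      _ = A * (m.choose s * (m - s)) := by rw [Nat.choose_succ_right_eq]
      _ ≤ A * (m.choose s * m) := by gcongr; omega
      _ = A * m * m.choose s := by ring
      _ ≤ (s + 1) * L * m.choose s := by gcongr
      _ = (s + 1) * (L * m.choose s) := by ring
  rw [add_mul, one_mul]
  omega

theorem choose_le_mul_choose {A m s L : ℕ} {δ : ℝ} (hδ : 1 ≤ δ * (A + 1)) (hs : 1 ≤ s)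
    (hm : s ≤ m) (hL : A * m ≤ s * L) :
    (m.choose (min (m + L) s) : ℝ) ≤ δ * ((m + L).choose (min (m + L) s) : ℝ) := by
  rw [min_eq_right (by omega)]
  have h : ((A : ℝ) + 1) * m.choose s ≤ (m + L).choose s := by
    exact_mod_cast mul_choose_le_choose_add hs hL
  have hA : (0 : ℝ) < A + 1 := by positivity
  have hδ0 : 0 < δ := pos_of_mul_pos_left (zero_lt_one.trans_le hδ) hA.le
  calc (m.choose s : ℝ) ≤ δ * (A + 1) * m.choose s := le_mul_of_one_le_left (by positivity) hδ
    _ = δ * ((A + 1) * m.choose s) := by ring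
    _ ≤ _ := by gcongr

theorem bound_eq (k s n : ℕ) :
    bound k s n = k * Real.log (n / s) / Real.log (1 + k / s) := by
  have : Real.log 2 ≠ 0 := (Real.log_pos one_lt_two).ne'
  rw [bound, Real.logb, Real.logb, mul_div_assoc, div_div_div_cancel_right₀ this, mul_div_assoc]

/-- Bernoulli's inequality gives `1 + (A + 1) * (k / s) ≤ (1 + k / s) ^ (A + 1)`, so the faster
growth costs only a factor `A + 1` in the number of stages. -/
theorem bound_le_of_le_pow {A k s n e : ℕ} (hk : 1 ≤ k) (hs : 1 ≤ s) (hn : 1 ≤ n)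
    (h : (n : ℝ) ≤ s * (1 + (A + 1) * (k / s)) ^ e) : bound k s n ≤ e * (A + 1) * k := by
  have hs' : (0 : ℝ) < s := by exact_mod_cast hs
  have hk' : (0 : ℝ) < k := by exact_mod_cast hk
  have hn' : (0 : ℝ) < n := by exact_mod_cast hn
  have hlog : 0 < Real.log (1 + k / s) := Real.log_pos (by
    have : (0 : ℝ) < k / s := by positivity
    linarith)
  have h1 : Real.log (n / s) ≤ e * ((A + 1) * Real.log (1 + k / s)) := by
    have hz : (0 : ℝ) ≤ k / s := by positivity
    calc Real.log (n / s) ≤ Real.log ((1 + (A + 1) * (k / s)) ^ e) := by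
          refine Real.log_le_log (by positivity) ?_
          rw [div_le_iff₀ hs']
          linarith
      _ = e * Real.log (1 + (A + 1) * (k / s)) := Real.log_pow _ _
      _ ≤ e * Real.log ((1 + k / s) ^ (A + 1)) := by
          gcongr
          have := one_add_mul_le_pow (show (-2 : ℝ) ≤ k / s by linarith) (A + 1)
          push_cast at this
          exact this
      _ = _ := by rw [Real.log_pow]; push_cast; ring
  rw [bound_eq, div_le_iff₀ hlog]
  calc (k : ℝ) * Real.log (n / s) ≤ k * (e * ((A + 1) * Real.log (1 + k / s))) := by gcongr
    _ = _ := by ring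

/-- Both logarithms are linearized: `log (n / s) ≤ (n - s) / s` and `log (1 + k / s) ≥ k / (s + k) ≥
k / (3 * s)`. This serves when `n` is too close to `s` for a full stage. -/
theorem bound_le_three_mul {k s n : ℕ} (hk : 1 ≤ k) (hs : 1 ≤ s) (hn : s ≤ n) (hks : k ≤ 2 * s) :
    bound k s n ≤ 3 * (n - s) := by
  have hs' : (0 : ℝ) < s := by exact_mod_cast hs
  have hk' : (0 : ℝ) < k := by exact_mod_cast hk
  have hn' : (0 : ℝ) < n := by exact_mod_cast hs.trans hn
  have hns : (s : ℝ) ≤ n := by exact_mod_cast hn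
  have hks' : (k : ℝ) ≤ 2 * s := by exact_mod_cast hks
  have h1 : Real.log (n / s) ≤ (n - s) / s := by
    refine (Real.log_le_sub_one_of_pos (by positivity)).trans (le_of_eq ?_)
    field_simp
  have h2 : (k : ℝ) / (3 * s) ≤ Real.log (1 + k / s) := by
    refine le_trans ?_ (Real.one_sub_inv_le_log_of_pos (by positivity))
    have : 1 - (1 + (k : ℝ) / s)⁻¹ = k / (s + k) := by
      field_simp
      ring
    rw [this]
    exact div_le_div_of_nonneg_left hk'.le (by positivity) (by linarith)
  have hpos : (0 : ℝ) < k / (3 * s) := by positivity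
  rw [bound_eq, div_le_iff₀ (hpos.trans_le h2)]
  calc (k : ℝ) * Real.log (n / s) ≤ k * ((n - s) / s) := by gcongr
    _ = 3 * (n - s) * (k / (3 * s)) := by field_simp
    _ ≤ _ := by
      have : (0 : ℝ) ≤ 3 * (n - s) := by linarith
      gcongr

/-- The number of elements before the stages in which all sites take part. -/
def stageCount (A k s : ℕ) : ℕ → ℕ
  | 0 => s
  | i + 1 => stageCount A k s i + k * (A * stageCount A k s i / s + 1)

theorem le_stageCount (A k s i : ℕ) : s ≤ stageCount A k s i := by
  induction i with
  | zero => rfl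
  | succ i ih => rw [stageCount]; omega

/-- The `+ 1` from rounding up is at most `stageCount A k s i / s`, which turns the factor `A` into
`A + 1`. -/
theorem stageCount_le {A k s : ℕ} (hs : 1 ≤ s) (i : ℕ) :
    (stageCount A k s i : ℝ) ≤ s * (1 + (A + 1) * (k / s)) ^ i := by
  have hs' : (0 : ℝ) < s := by exact_mod_cast hs
  induction i with
  | zero => simp [stageCount]
  | succ i ih =>
    have h1 : (s : ℝ) ≤ stageCount A k s i := by exact_mod_cast le_stageCount A k s i
    have h2 : ((A * stageCount A k s i / s : ℕ) : ℝ) ≤ A * stageCount A k s i / s := by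
      exact_mod_cast Nat.cast_div_le
    have h3 : (1 : ℝ) ≤ stageCount A k s i / s := (one_le_div hs').2 h1
    rw [stageCount]
    push_cast
    calc (stageCount A k s i : ℝ) + k * (((A * stageCount A k s i / s : ℕ) : ℝ) + 1)
        ≤ stageCount A k s i + k * (A * stageCount A k s i / s + stageCount A k s i / s) := by
          gcongr
      _ = stageCount A k s i * (1 + (A + 1) * (k / s)) := by
          field_simp
      _ ≤ _ := by
          rw [pow_succ, ← mul_assoc]
          gcongr

theorem add_le_stageCount {A k s : ℕ} (hk : 1 ≤ k) (i : ℕ) : s + i ≤ stageCount A k s i := by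
  induction i with
  | zero => rfl
  | succ i ih =>
    rw [stageCount]
    have : 1 ≤ k * (A * stageCount A k s i / s + 1) := Nat.mul_pos hk (Nat.succ_pos _)
    omega

/-- In stage `0` of the two main cases one site observes `s` elements, so that later samples have
size exactly `s`; then come stages with blocks just long enough for the `δ` estimate. The last stage
only supplies the remaining elements. -/
theorem exists_stages {A : ℕ} {δ : ℝ} (hδ : 1 ≤ δ * (A + 1)) {k s n : ℕ} (hk : 1 ≤ k)
    (hs : 1 ≤ s) (hkn : k ≤ n) :
    ∃ (E : ℕ) (sites len : ℕ → ℕ), (∀ i < E + 1, sites i ≤ k) ∧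
      ∑ i ∈ Finset.range (E + 1), sites i * len i = n ∧
      (∀ i < E, 0 < len i) ∧
      (∀ i < E, ∀ m, m = ∑ i' ∈ Finset.range i, sites i' * len i' →
        (m.choose (min (m + len i) s) : ℝ) ≤
          δ * ((m + len i).choose (min (m + len i) s) : ℝ)) ∧
      bound k s n ≤ 3 * (A + 1) ^ 2 * (∑ i ∈ Finset.range E, sites i : ℕ) := by
  have hs' : (0 : ℝ) < s := by exact_mod_cast hs
  have hA : (1 : ℝ) ≤ A + 1 := by
    have : (0 : ℝ) ≤ A := by positivity
    linarith
  have hk' : (0 : ℝ) < k := by exact_mod_cast hk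
  have hδ0 : 0 < δ := pos_of_mul_pos_left (zero_lt_one.trans_le hδ) (by positivity)
  have hfirst : ((Nat.choose 0 (min (0 + s) s) : ℕ) : ℝ) ≤
      δ * ((0 + s).choose (min (0 + s) s) : ℝ) := by
    obtain ⟨s, rfl⟩ := Nat.exists_eq_add_of_le' hs
    simpa using hδ0.le
  rcases le_or_gt n s with hns | hns
  -- Here `bound k s n ≤ 0`, so no stage needs to count.
  · refine ⟨0, fun _ => 1, fun _ => n, fun _ _ => hk, by simp, by simp, by simp, ?_⟩
    have hn' : (n : ℝ) ≤ s * (1 + (A + 1) * (k / s)) ^ 0 := by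
      simpa using hns
    simpa using bound_le_of_le_pow hk hs (hk.trans hkn) hn'
  -- After `s` elements, a full stage takes `k * (A + 1)` more. If they are not available, only `(n
  -- - s) / (A + 1)` sites get a block.
  rcases lt_or_ge n (s + k * (A + 1)) with hnk | hnk
  · refine ⟨2, fun i => if i = 1 then (n - s) / (A + 1) else 1,
      fun i => if i = 0 then s else if i = 1 then A + 1 else (n - s) % (A + 1), ?_, ?_, ?_, ?_, ?_⟩
    · intro i _
      simp only
      split_ifs
      · exact Nat.div_le_of_le_mul (by rw [mul_comm]; omega)
      · exact hk
    · have := Nat.div_add_mod' (n - s) (A + 1)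
      simp [Finset.sum_range_succ]
      omega
    · intro i hi
      interval_cases i
      · simpa using Nat.pos_of_ne_zero (by omega)
      · simp
    · intro i hi m hm
      interval_cases i
      · simp only [Finset.range_zero, Finset.sum_empty] at hm
        subst hm
        simpa using hfirst
      · simp only [Finset.sum_range_succ, Finset.range_zero, Finset.sum_empty] at hm
        norm_num at hm
        subst hm
        simpa using choose_le_mul_choose hδ hs le_rfl (L := A + 1) (by nlinarith)
    · have hK : (n - s : ℝ) ≤ (A + 1) * (((n - s) / (A + 1) : ℕ) + 1 : ℝ) := by
        have h1 := (Nat.lt_mul_div_succ (n - s) (Nat.succ_pos A)).le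
        have h2 : ((n - s : ℕ) : ℝ) ≤ (A + 1) * (((n - s) / (A + 1) : ℕ) + 1 : ℝ) := by
          exact_mod_cast h1
        rwa [Nat.cast_sub hns.le] at h2
      simp only [Finset.sum_range_succ, Finset.range_zero, Finset.sum_empty]
      norm_num
      have hpos : (0 : ℝ) ≤ (((n - s) / (A + 1) : ℕ) + 1 : ℝ) := by positivity
      rcases le_total k (2 * s) with hks | hks
      · have h3 := bound_le_three_mul hk hs hns.le hks
        nlinarith [mul_le_mul_of_nonneg_right hA (mul_nonneg (zero_le_one.trans hA) hpos)]
      · have h3 : bound k s n ≤ (1 : ℕ) * (A + 1) * k := by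
          refine bound_le_of_le_pow hk hs (hk.trans hkn) ?_
          have : (n : ℝ) ≤ s + k * (A + 1) := by exact_mod_cast hnk.le
          refine this.trans (le_of_eq ?_)
          field_simp
        -- This is where `k ≤ n` matters: with `2 * s ≤ k` it leaves at least `k / 2` elements
        -- beyond the first `s`.
        have h4 : (k : ℝ) ≤ 2 * (n - s) := by
          have h5 : (k : ℝ) ≤ n := by exact_mod_cast hkn
          have h6 : (2 : ℝ) * s ≤ k := by exact_mod_cast hks
          linarith
        calc bound k s n ≤ (A + 1) * k := by simpa using h3
          _ ≤ (A + 1) * (2 * ((A + 1) * (((n - s) / (A + 1) : ℕ) + 1 : ℝ))) := by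
            gcongr
            linarith
          _ ≤ _ := by nlinarith [mul_nonneg (sq_nonneg ((A : ℝ) + 1)) hpos]
  · have hex : ∃ e, n < stageCount A k s (e + 1) :=
      ⟨n, lt_of_lt_of_le (by omega) (add_le_stageCount hk (n + 1))⟩
    classical
    -- `e` is the number of full stages that fit into `n` elements; `e ≥ 1` lets `e + 1` be absorbed
    -- into `2 * e` below.
    set e := Nat.find hex with he
    have he1 : n < stageCount A k s (e + 1) := Nat.find_spec hex
    have he0 : e ≠ 0 := by
      intro h0
      rw [h0] at he1
      simp only [stageCount] at he1
      rw [Nat.mul_div_cancel _ hs] at he1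
      omega
    have he2 : stageCount A k s e ≤ n := by
      have := Nat.find_min hex (show e - 1 < e by omega)
      rw [Nat.sub_add_cancel (by omega)] at this
      omega
    set sites : ℕ → ℕ := fun i => if i = 0 then 1 else if i ≤ e then k else 1 with hsites
    set len : ℕ → ℕ := fun i => if i = 0 then s else if i ≤ e then
      A * stageCount A k s (i - 1) / s + 1 else n - stageCount A k s e with hlen
    have hsum : ∀ i ≤ e, ∑ i' ∈ Finset.range (i + 1), sites i' * len i' = stageCount A k s i := by
      intro i hi
      induction i with
      | zero => simp [hsites, hlen, stageCount]
      | succ i ih =>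
        rw [Finset.sum_range_succ, ih (by omega)]
        simp [hsites, hlen, stageCount, hi]
    have hK : ∀ i ≤ e, ∑ i' ∈ Finset.range (i + 1), sites i' = 1 + i * k := by
      intro i hi
      induction i with
      | zero => simp [hsites]
      | succ i ih =>
        rw [Finset.sum_range_succ, ih (by omega)]
        simp [hsites, hi]
        ring
    refine ⟨e + 1, sites, len, ?_, ?_, ?_, ?_, ?_⟩
    · intro i _
      simp only [hsites]
      split_ifs <;> omega
    · rw [Finset.sum_range_succ, hsum e le_rfl]
      simp [hsites, hlen]
      omega
    · intro i hi
      simp only [hlen]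
      split_ifs
      · omega
      · exact Nat.succ_pos _
      · omega
    · intro i hi m hm
      rcases Nat.eq_zero_or_pos i with rfl | hpos
      · simp only [Finset.range_zero, Finset.sum_empty] at hm
        subst hm
        simpa [hlen] using hfirst
      · obtain ⟨i, rfl⟩ := Nat.exists_eq_add_of_le' hpos
        rw [hsum i (by omega)] at hm
        subst hm
        refine choose_le_mul_choose hδ hs (le_stageCount _ _ _ _) ?_
        simp only [hlen]
        rw [if_neg (by omega), if_pos (by omega), Nat.add_sub_cancel]
        exact (Nat.lt_mul_div_succ _ hs).le
    · rw [hK e le_rfl]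
      have h3 : bound k s n ≤ ((e + 1 : ℕ) : ℝ) * (A + 1) * k := by
        refine bound_le_of_le_pow hk hs (hk.trans hkn) ?_
        exact (Nat.cast_le.2 he1.le).trans (stageCount_le hs (e + 1))
      have he' : (1 : ℝ) ≤ e := by exact_mod_cast Nat.one_le_iff_ne_zero.2 he0
      refine h3.trans ?_
      push_cast
      calc ((e : ℝ) + 1) * (A + 1) * k ≤ (2 * e) * (A + 1) * k := by gcongr; linarith
        _ = 2 * (A + 1) * (e * k) := by ring
        _ ≤ 3 * (A + 1) ^ 2 * (1 + e * k) := by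
          gcongr
          · norm_num
          · nlinarith
          · linarith

/-! ### Averaging over the random windows, and the theorem -/

theorem tsum_map_uniformOfFintype_mul {ι β : Type*} [Fintype ι] [Nonempty ι] (f : ι → β)
    (g : β → ℝ≥0∞) : ∑' x, (PMF.uniformOfFintype ι).map f x * g x =
      (Fintype.card ι : ℝ≥0∞)⁻¹ * ∑ u, g (f u) := by
  classical
  simp only [PMF.map_apply, ← ENNReal.tsum_mul_right]
  rw [ENNReal.tsum_comm, tsum_fintype, Finset.mul_sum]
  refine Finset.sum_congr rfl fun u _ => ?_
  rw [tsum_eq_single (f u) fun x hx => by simp [hx]]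
  simp

theorem ofReal_mul_measure_le_lintegral {Ω : Type*} [MeasurableSpace Ω] (μ : Measure Ω)
    {M : Ω → ℕ} (hM : Measurable M) (K : ℕ) :
    ENNReal.ofReal (K / 2) * μ {ω | K ≤ 2 * M ω} ≤ ∫⁻ ω, (M ω : ℝ≥0∞) ∂μ := by
  have hM' : Measurable fun ω => (M ω : ℝ≥0∞) := by fun_prop
  refine le_trans ?_ (mul_meas_ge_le_lintegral hM' (ENNReal.ofReal (K / 2)))
  gcongr
  intro h
  rw [← ENNReal.ofReal_natCast]
  refine ENNReal.ofReal_le_ofReal ?_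
  rw [div_le_iff₀ two_pos]
  rw [mul_comm]
  exact_mod_cast h

end DistributedSampling

open MeasureTheory DistributedSampling in
theorem theorem3 (q : ℝ) (hq0 : 0 < q) (hq1 : q < 1) :
    ∃ C : ℝ, 0 < C ∧
      ∀ (k s n : ℕ) (α : Type*), 1 ≤ k → 1 ≤ s → k ≤ n → Nonempty (Fin n ↪ α) →
        -- a distribution on inputs with `n` elements, which does not depend on the protocol
        ∃ (T : ℕ) (ν : PMF (Input k α)),
          (∀ x ∈ ν.support, x.Distinct ∧ (x.arrived T).card = n) ∧
          ∀ (Ω U D : Type*) [MeasurableSpace Ω] (μ : Measure Ω) [IsProbabilityMeasure μ]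
            (P : Protocol k α Ω U D), P.IsMeasurable → P.Correct μ s →
            -- on the random input
            ENNReal.ofReal (1 - q) ≤
              ∑' x, ν x * μ {ω | C * bound k s n ≤ (P.messages ω x T : ℝ)} ∧
            ENNReal.ofReal (C * bound k s n) ≤
              ∑' x, ν x * ∫⁻ ω, (P.messages ω x T : ENNReal) ∂μ ∧
            -- on a fixed input, over the internal randomness of the protocol alone
            ∃ x ∈ ν.support,
              ENNReal.ofReal (1 - q) ≤ μ {ω | C * bound k s n ≤ (P.messages ω x T : ℝ)} ∧
              ENNReal.ofReal (C * bound k s n) ≤ ∫⁻ ω, (P.messages ω x T : ENNReal) ∂μ := by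
  -- With `δ = q / 4`, the failure probability `4 * δ` is exactly `q`.
  obtain ⟨A, hA⟩ : ∃ A : ℕ, 1 ≤ q / 4 * (A + 1) := by
    obtain ⟨A, hA⟩ := exists_nat_ge (4 / q)
    refine ⟨A, ?_⟩
    rw [div_le_iff₀ hq0] at hA
    linarith
  have hA0 : (0 : ℝ) < 6 * (A + 1) ^ 2 := by positivity
  have hq : 0 < 1 - q := by linarith
  -- The factor `3 * (A + 1) ^ 2` comes from `exists_stages`, the `2` from counting `K / 2`
  -- messages, and `1 - q` is the loss in passing from probability to expectation.
  refine ⟨(1 - q) / (6 * (A + 1) ^ 2), div_pos hq hA0, ?_⟩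
  intro k s n α hk hs hkn ⟨f⟩
  obtain ⟨E, sites, len, hsites, hsum, hlen, hchoose, hbound⟩ := exists_stages hA hk hs hkn
  have hn : 0 < n := hk.trans hkn
  set K := ∑ i ∈ Finset.range E, sites i with hK
  obtain ⟨N, hN⟩ := exists_nat_ge (K / (q / 4))
  rw [div_le_iff₀ (by positivity)] at hN
  let Q : Schedule α :=
    { sites := sites
      len := len
      -- The reduction modulo `n` only makes `item` total; indices in use are below `n`.
      item := fun i => f ⟨i % n, Nat.mod_lt i hn⟩
      -- The `+ 1` keeps a window available when `K = 0`.
      slots := N + 1 }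
  have hQ : Q.before (E + 1) = n := hsum
  have hitem : Set.InjOn Q.item (Set.Iio (Q.before (E + 1))) := by
    rw [hQ]
    intro i hi i' hi' h
    have h1 := congrArg Fin.val (f.injective h)
    simpa [Nat.mod_eq_of_lt (Set.mem_Iio.1 hi), Nat.mod_eq_of_lt (Set.mem_Iio.1 hi')] using h1
  have hslots : 0 < Q.slots := Nat.succ_pos N
  have hKslots : (K : ℝ) ≤ q / 4 * Q.slots := by
    have : (Q.slots : ℝ) = N + 1 := by simp [Q]
    rw [this]
    linarith
  have : Nonempty (Fin (E + 1) → Fin Q.slots) := ⟨fun _ => ⟨0, hslots⟩⟩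
  set T := Q.stageStart (E + 1) with hT
  set z : (Fin (E + 1) → Fin Q.slots) → Input k α :=
    fun u => Q.input k (Schedule.extend u) (E + 1) with hz
  refine ⟨T, (PMF.uniformOfFintype (Fin (E + 1) → Fin Q.slots)).map z, ?_, ?_⟩
  · intro x hx
    obtain ⟨u, -, rfl⟩ := (PMF.mem_support_map_iff _ _ _).1 hx
    exact ⟨Schedule.input_distinct hitem,
      (Schedule.card_arrived_input (Schedule.extend_lt hslots u) hitem hsites le_rfl).trans hQ⟩
  intro Ω U D _ μ _ P hP hc
  set V : ℝ := (1 - q) / (6 * (A + 1) ^ 2) * bound k s n with hV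
  have hVK : V ≤ (1 - q) * (K / 2) := by
    rw [hV, div_mul_eq_mul_div, mul_div_assoc]
    refine mul_le_mul_of_nonneg_left ?_ hq.le
    rw [div_le_iff₀ hA0]
    linarith
  have hVK' : V ≤ K / 2 := hVK.trans (mul_le_of_le_one_left (by positivity) (by linarith))
  have hsub : ∀ x, μ {ω | K ≤ 2 * P.messages ω x T} ≤ μ {ω | V ≤ (P.messages ω x T : ℝ)} := by
    intro x
    refine measure_mono fun ω hω => hVK'.trans ?_
    have : (K : ℝ) ≤ 2 * P.messages ω x T := by exact_mod_cast hω
    linarith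
  have hexp : ∀ x, ENNReal.ofReal (K / 2) * μ {ω | K ≤ 2 * P.messages ω x T} ≤
      ∫⁻ ω, (P.messages ω x T : ENNReal) ∂μ := fun x =>
    ofReal_mul_measure_le_lintegral μ (hP.measurable_messages x T) K
  have hVofReal : ENNReal.ofReal V ≤ ENNReal.ofReal (K / 2) * ENNReal.ofReal (1 - q) := by
    rw [← ENNReal.ofReal_mul (by positivity), mul_comm]
    exact ENNReal.ofReal_le_ofReal hVK
  have hmain := Schedule.sum_measureReal_messages_ge (Q := Q) (μ := μ) (P := P) (δ := q / 4)
    (T := T) hslots hitem hsites hP hc hlen le_rfl (fun i hi => hchoose i hi _ rfl) (by positivity)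
    hKslots
  change _ ≤ ∑ u, μ.real {ω | K ≤ 2 * P.messages ω (z u) T} at hmain
  rw [show 1 - 4 * (q / 4) = 1 - q by ring] at hmain
  have hcard : ((Fintype.card (Fin (E + 1) → Fin Q.slots) : ℕ) : ℝ) = Q.slots ^ (E + 1) := by
    simp
  have havg : ENNReal.ofReal (1 - q) ≤
      ∑' x, (PMF.uniformOfFintype (Fin (E + 1) → Fin Q.slots)).map z x *
        μ {ω | K ≤ 2 * P.messages ω x T} := by
    rw [tsum_map_uniformOfFintype_mul]
    have h1 : ∑ u, μ {ω | K ≤ 2 * P.messages ω (z u) T} =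
        ENNReal.ofReal (∑ u, μ.real {ω | K ≤ 2 * P.messages ω (z u) T}) := by
      rw [ENNReal.ofReal_sum_of_nonneg fun _ _ => measureReal_nonneg]
      exact Finset.sum_congr rfl fun u _ => (ofReal_measureReal).symm
    rw [h1, mul_comm, ← div_eq_mul_inv, ENNReal.le_div_iff_mul_le
      (Or.inl (by exact_mod_cast Fintype.card_ne_zero)) (Or.inl (ENNReal.natCast_ne_top _)),
      ← ENNReal.ofReal_natCast, ← ENNReal.ofReal_mul hq.le, hcard, mul_comm]
    exact ENNReal.ofReal_le_ofReal hmain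
  refine ⟨havg.trans (ENNReal.tsum_le_tsum fun x => mul_le_mul_right (hsub x) _), ?_, ?_⟩
  · refine hVofReal.trans ((mul_le_mul_right havg _).trans ?_)
    rw [← ENNReal.tsum_mul_left]
    refine ENNReal.tsum_le_tsum fun x => ?_
    rw [mul_left_comm]
    gcongr
    exact hexp x
  -- One choice of windows that is at least average serves both bounds, since the expectation bound
  -- follows from the probability bound for the same input.
  · obtain ⟨u, -, hu⟩ := Finset.exists_le_of_sum_le (s := Finset.univ)
      (f := fun _ : Fin (E + 1) → Fin Q.slots => 1 - q)
      (g := fun u => μ.real {ω | K ≤ 2 * P.messages ω (z u) T}) Finset.univ_nonempty (by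
        rw [Finset.sum_const, Finset.card_univ, nsmul_eq_mul, hcard]
        exact hmain)
    have hu' : ENNReal.ofReal (1 - q) ≤ μ {ω | K ≤ 2 * P.messages ω (z u) T} :=
      (ENNReal.ofReal_le_ofReal hu).trans_eq ofReal_measureReal
    refine ⟨z u, (PMF.mem_support_map_iff _ _ _).2 ⟨u, by simp, rfl⟩, hu'.trans (hsub _), ?_⟩
    exact hVofReal.trans ((mul_le_mul_right hu' _).trans (hexp _))
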